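/- Let $\Bbbk$ be a field. An algebra is a $\Bbbk$-linear space with one bilinear product (not assumed associative or unital). Let $\mathrm{Var}$ be the variety of algebras defined by a set $S$ of polylinear identities: each $\Phi\in S$ is, for some $n$, an element of the free nonassociative algebra on $x_1,x_2,\dots$ in every monomial of which each of $x_1,\dots,x_n$ occurs exactly once and no other variable occurs. Denote by $\mathrm{Var}\langle Y\rangle$ the free algebra of $\mathrm{Var}$ generated by a set $Y$. A tri-algebra is a linear space with three bilinear operations $\dashv,\vdash,\perp$; a di-algebra has only $\dashv,\vdash$. For $\Phi\in S$ of degree $n$ and $\varnothing\ne H\subseteq\{1,\dots,n\}$, let $\Phi_H$ be the polynomial with operations $\dashv,\vdash,\perp$ obtained by emphasizing the variables $x_i$, $i\in H$, in each monomial of $\Phi$ and replacing every product $uv$ of subwords by $u\dashv v$ if only $u$ contains emphasized variables, $u\vdash v$ if only $v$ does, $u\perp v$ if both do, and $u\dashv v$ if neither does. The variety $\text{tri-}\mathrm{Var}$ consists of the tri-algebras with $$(a* b)\vdash c=(a\star b)\vdash c,\qquad a\dashv(b* c)=a\dashv(b\star c)\qquad (*,\star\in\{\dashv,\vdash,\perp\})$$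 and $\Phi_H=0$ for all $\Phi\in S$ and all nonempty $H$. The variety $\text{di-}\mathrm{Var}$ consists of the di-algebras satisfying the displayed identities for $*,\star\in\{\dashv,\vdash\}$ and $\Phi_{\{i\}}=0$ for all $\Phi\in S$, $1\le i\le\deg\Phi$. Let $X$ be a set, $\dot X=\{\dot x\mid x\in X\}$ a disjoint copy of $X$, and $F=\mathrm{Var}\langle X\cup\dot X\rangle$. Let $\varphi:F\to\mathrm{Var}\langle X\rangle\subseteq F$ be the homomorphism with $\varphi(x)=\varphi(\dot x)=x$ for $x\in X$. Put on $F$ $$f\vdash g=\varphi(f)g,\qquad f\dashv g=f\varphi(g),\qquad f\perp g=fg .$$ **Theorem 3.3.** 1. The subalgebra $V$ of $(F,\vdash,\dashv,\perp)$ generated by $\dot X$ is the linear span of (the images in $F$ of) all nonassociative words in $X\cup\dot X$ of positive degree in $\dot X$. With the map $x\mapsto\dot x$ it is the free algebra generated by $X$ in $\text{tri-}\mathrm{Var}$: $V\in\text{tri-}\mathrm{Var}$, and for every $A\in\text{tri-}\mathrm{Var}$ and every map $\alpha:X\to A$ there is a unique homomorphism of tri-algebras $\chi:V\to A$ with $\chi(\dot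 x)=\alpha(x)$ for all $x\in X$. 2. The subalgebra of $(F,\vdash,\dashv)$ generated by $\dot X$ is the linear span of (the images in $F$ of) all nonassociative words in $X\cup\dot X$ of degree exactly $1$ in $\dot X$. With the map $x\mapsto\dot x$ it is, in the same sense, the free algebra generated by $X$ in $\text{di-}\mathrm{Var}$. -/

import Mathlib

universe u v w

namespace Replication

noncomputable section

/-! ## Varieties of algebras with one binary product -/

/-- The free magmatic `k`-algebra `Alg⟨X⟩`: linear combinations of nonassociative words. -/
abbrev Alg (k : Type u) [Field k] (X : Type v) : Type (max u v) :=
  FreeNonUnitalNonAssocAlgebra k X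

/-- The multiset of letters of a nonassociative word. -/
def leaves {X : Type v} : FreeMagma X → Multiset X
  | .of x => {x}
  | .mul s t => leaves s + leaves t

/-- `Φ` is polylinear of degree `n` in the variables `x₀, …, xₙ₋₁`: each of them occurs exactly once
in every monomial of `Φ`, and no other variable occurs. -/
def IsPolylinear {k : Type u} [Field k] (n : ℕ) (Φ : Alg k ℕ) : Prop :=
  ∀ t ∈ Φ.coeff.support, leaves t = Multiset.range n

/-- The variety `Var` defined by the set `S` of identities: membership of an algebra `A`. -/
def InVar {k : Type u} [Field k] (S : Set (Alg k ℕ)) (A : Type w) [NonUnitalNonAssocRing A]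
    [Module k A] [IsScalarTower k A A] [SMulCommClass k A A] : Prop :=
  ∀ Φ ∈ S, ∀ a : ℕ → A, FreeNonUnitalNonAssocAlgebra.lift k a Φ = 0

/-- The ideal of `Alg⟨X⟩` generated by all values of the polynomials from `S`. -/
def verbalIdeal {k : Type u} [Field k] (S : Set (Alg k ℕ)) (X : Type v) :
    Submodule k (Alg k X) :=
  sInf {I | (∀ a : Alg k X, ∀ b ∈ I, a * b ∈ I ∧ b * a ∈ I) ∧
    ∀ Φ ∈ S, ∀ a : ℕ → Alg k X, FreeNonUnitalNonAssocAlgebra.lift k a Φ ∈ I}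

theorem verbalIdeal_mul {k : Type u} [Field k] (S : Set (Alg k ℕ)) (X : Type v)
    (a : Alg k X) {b : Alg k X} (hb : b ∈ verbalIdeal S X) :
    a * b ∈ verbalIdeal S X ∧ b * a ∈ verbalIdeal S X := by
  simp only [verbalIdeal, Submodule.mem_sInf] at hb ⊢
  exact ⟨fun I hI => (hI.1 a b (hb I hI)).1, fun I hI => (hI.1 a b (hb I hI)).2⟩

theorem lift_mem_verbalIdeal {k : Type u} [Field k] {S : Set (Alg k ℕ)} (X : Type v)
    {Φ : Alg k ℕ} (hΦ : Φ ∈ S) (a : ℕ → Alg k X) :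
    FreeNonUnitalNonAssocAlgebra.lift k a Φ ∈ verbalIdeal S X := by
  simp only [verbalIdeal, Submodule.mem_sInf]
  exact fun I hI => hI.2 Φ hΦ a

/-- The free algebra `Var⟨X⟩`. -/
def FreeVar {k : Type u} [Field k] (S : Set (Alg k ℕ)) (X : Type v) : Type (max u v) :=
  Alg k X ⧸ verbalIdeal S X

namespace FreeVar

variable {k : Type u} [Field k] (S : Set (Alg k ℕ)) (X : Type v)

instance : AddCommGroup (FreeVar S X) :=
  inferInstanceAs (AddCommGroup (Alg k X ⧸ verbalIdeal S X))

instance : Module k (FreeVar S X) :=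
  inferInstanceAs (Module k (Alg k X ⧸ verbalIdeal S X))

/-- The quotient map `Alg⟨X⟩ → Var⟨X⟩`. -/
def mk : Alg k X →ₗ[k] FreeVar S X := (verbalIdeal S X).mkQ

theorem mk_surjective : Function.Surjective (mk S X) := (verbalIdeal S X).mkQ_surjective

theorem mk_eq_zero (a : Alg k X) : mk S X a = 0 ↔ a ∈ verbalIdeal S X :=
  Submodule.Quotient.mk_eq_zero _

/-- Multiplication of classes in `Var⟨X⟩`. -/
def mulMap : FreeVar S X →ₗ[k] FreeVar S X →ₗ[k] FreeVar S X :=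
  (verbalIdeal S X).liftQ
    { toFun := fun a => (verbalIdeal S X).liftQ ((mk S X).comp (LinearMap.mulLeft k a))
        (fun _ hb => (mk_eq_zero S X _).2 (verbalIdeal_mul S X a hb).1)
      map_add' := fun a b => by
        refine LinearMap.ext fun z => ?_
        obtain ⟨c, rfl⟩ := (verbalIdeal S X).mkQ_surjective z
        change mk S X ((a + b) * c) = mk S X (a * c) + mk S X (b * c)
        rw [add_mul, map_add]
      map_smul' := fun r a => by
        refine LinearMap.ext fun z => ?_
        obtain ⟨c, rfl⟩ := (verbalIdeal S X).mkQ_surjective z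
        change mk S X ((r • a) * c) = r • mk S X (a * c)
        rw [smul_mul_assoc, map_smul] }
    (fun a ha => by
      refine LinearMap.ext fun z => ?_
      obtain ⟨c, rfl⟩ := (verbalIdeal S X).mkQ_surjective z
      exact (mk_eq_zero S X _).2 (verbalIdeal_mul S X c ha).2)

instance : NonUnitalNonAssocRing (FreeVar S X) :=
  { (inferInstance : AddCommGroup (FreeVar S X)) with
    mul := fun a b => mulMap S X a b
    left_distrib := fun a b c => map_add (mulMap S X a) b c
    right_distrib := fun a b c => LinearMap.congr_fun (map_add (mulMap S X) a b) c
    zero_mul := fun a => LinearMap.congr_fun (map_zero (mulMap S X)) a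
    mul_zero := fun a => map_zero (mulMap S X a) }

instance : IsScalarTower k (FreeVar S X) (FreeVar S X) :=
  ⟨fun r a b => LinearMap.congr_fun (map_smul (mulMap S X) r a) b⟩

instance : SMulCommClass k (FreeVar S X) (FreeVar S X) :=
  ⟨fun r a b => (map_smul (mulMap S X a) r b).symm⟩

/-- The quotient map as a homomorphism of algebras. -/
def mkHom : Alg k X →ₙₐ[k] FreeVar S X :=
  { mk S X with
    map_zero' := map_zero (mk S X)
    map_mul' := fun _ _ => rfl }

/-- The generators of `Var⟨X⟩`. -/
def of (x : X) : FreeVar S X := mkHom S X (FreeNonUnitalNonAssocAlgebra.of k x)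

theorem inVar : InVar S (FreeVar S X) := by
  intro Φ hΦ a
  choose b hb using fun i => mk_surjective S X (a i)
  have h : FreeNonUnitalNonAssocAlgebra.lift k a =
      (mkHom S X).comp (FreeNonUnitalNonAssocAlgebra.lift k b) :=
    FreeNonUnitalNonAssocAlgebra.hom_ext k fun i => by
      simp only [FreeNonUnitalNonAssocAlgebra.lift_of_apply, NonUnitalAlgHom.comp_apply]
      exact (hb i).symm
  rw [h]
  exact (mk_eq_zero S X _).2 (lift_mem_verbalIdeal X hΦ b)

variable {S X} {A : Type w} [NonUnitalNonAssocRing A] [Module k A] [IsScalarTower k A A]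
  [SMulCommClass k A A]

theorem verbalIdeal_le_ker (hA : InVar S A) (f : X → A) :
    ∀ a ∈ verbalIdeal S X, FreeNonUnitalNonAssocAlgebra.lift k f a = 0 := by
  intro a ha
  let g := FreeNonUnitalNonAssocAlgebra.lift k f
  have := (Submodule.mem_sInf.1 ha) (LinearMap.ker (g : Alg k X →ₗ[k] A)) ⟨?_, ?_⟩
  · simpa using this
  · intro a b hb
    have hb : g b = 0 := by simpa using hb
    constructor <;> simp [hb]
  · intro Φ hΦ b
    have h : g.comp (FreeNonUnitalNonAssocAlgebra.lift k b) =
        FreeNonUnitalNonAssocAlgebra.lift k (fun i => g (b i)) :=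
      FreeNonUnitalNonAssocAlgebra.hom_ext k fun i => by simp
    have h2 := DFunLike.congr_fun h Φ
    rw [hA Φ hΦ] at h2
    simpa using h2

/-- The universal property of `Var⟨X⟩`: a map from `X` to an algebra in `Var` extends to a
homomorphism. -/
def lift (hA : InVar S A) (f : X → A) : FreeVar S X →ₙₐ[k] A :=
  { (verbalIdeal S X).liftQ (FreeNonUnitalNonAssocAlgebra.lift k f : Alg k X →ₗ[k] A)
      (fun a ha => verbalIdeal_le_ker hA f a ha) with
    map_zero' := map_zero _
    map_mul' := fun a b => by
      obtain ⟨a, rfl⟩ := mk_surjective S X a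
      obtain ⟨b, rfl⟩ := mk_surjective S X b
      exact map_mul (FreeNonUnitalNonAssocAlgebra.lift k f) a b }

theorem lift_of (hA : InVar S A) (f : X → A) (x : X) : lift hA f (of S X x) = f x :=
  FreeNonUnitalNonAssocAlgebra.lift_of_apply k f x

theorem hom_ext {f g : FreeVar S X →ₙₐ[k] A} (h : ∀ x, f (of S X x) = g (of S X x)) : f = g := by
  have : f.comp (mkHom S X) = g.comp (mkHom S X) := FreeNonUnitalNonAssocAlgebra.hom_ext k h
  refine NonUnitalAlgHom.ext fun a => ?_
  obtain ⟨a, rfl⟩ := mk_surjective S X a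
  exact DFunLike.congr_fun this a

end FreeVar

/-! ## Algebras with several bilinear operations -/

/-- A family of bilinear operations on `A`, indexed by `ι`. -/
abbrev Ops (ι : Type) (k : Type u) [Field k] (A : Type w) [AddCommGroup A] [Module k A] : Type _ :=
  ι → A →ₗ[k] A →ₗ[k] A

/-- Nonassociative words in `X` with operation symbols from `ι`: rooted binary trees with nodes
labelled by `ι` and leaves labelled by `X`. -/
inductive OpTree (ι : Type) (X : Type v) : Type v
  | leaf : X → OpTree ι X
  | node : ι → OpTree ι X → OpTree ι X → OpTree ι X

/-- The value of a word in an algebra. -/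
def OpTree.eval {ι : Type} {X : Type v} {k : Type u} [Field k] {A : Type w} [AddCommGroup A]
    [Module k A] (m : Ops ι k A) (a : X → A) : OpTree ι X → A
  | .leaf x => a x
  | .node p s t => m p (s.eval m a) (t.eval m a)

/-- The algebra satisfies the identity `Ψ = 0`, where `Ψ` is a linear combination of words. -/
def Satisfies {ι : Type} {X : Type v} {k : Type u} [Field k] {A : Type w} [AddCommGroup A]
    [Module k A] (m : Ops ι k A) (Ψ : OpTree ι X →₀ k) : Prop :=
  ∀ a : X → A, Finsupp.linearCombination k (OpTree.eval m a) Ψ = 0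

/-- The subalgebra generated by `s`. -/
def generated {ι : Type} {k : Type u} [Field k] {A : Type w} [AddCommGroup A] [Module k A]
    (m : Ops ι k A) (s : Set A) : Submodule k A :=
  sInf {W | s ⊆ W ∧ ∀ p, ∀ a ∈ W, ∀ b ∈ W, m p a b ∈ W}

theorem subset_generated {ι : Type} {k : Type u} [Field k] {A : Type w} [AddCommGroup A]
    [Module k A] (m : Ops ι k A) (s : Set A) : s ⊆ generated m s := by
  intro a ha
  exact Submodule.mem_sInf.2 fun W hW => hW.1 ha

theorem op_mem_generated {ι : Type} {k : Type u} [Field k] {A : Type w} [AddCommGroup A]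
    [Module k A] (m : Ops ι k A) (s : Set A) (p : ι) {a b : A} (ha : a ∈ generated m s)
    (hb : b ∈ generated m s) : m p a b ∈ generated m s :=
  Submodule.mem_sInf.2 fun W hW =>
    hW.2 p a (Submodule.mem_sInf.1 ha W hW) b (Submodule.mem_sInf.1 hb W hW)

/-- The operations of the subalgebra generated by `s`. -/
def generatedOps {ι : Type} {k : Type u} [Field k] {A : Type w} [AddCommGroup A]
    [Module k A] (m : Ops ι k A) (s : Set A) : Ops ι k (generated m s) :=
  fun p => LinearMap.mk₂ k
    (fun a b => ⟨m p a.1 b.1, op_mem_generated m s p a.2 b.2⟩)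
    (fun a b c => Subtype.ext (by simp))
    (fun r a b => Subtype.ext (by simp))
    (fun a b c => Subtype.ext (by simp))
    (fun r a b => Subtype.ext (by simp))

/-- The linear map `f` is a homomorphism with respect to all operations. -/
def IsOpHom {ι : Type} {k : Type u} [Field k] {A : Type v} [AddCommGroup A] [Module k A]
    {B : Type w} [AddCommGroup B] [Module k B] (mA : Ops ι k A) (mB : Ops ι k B)
    (f : A →ₗ[k] B) : Prop :=
  ∀ p a b, f (mA p a b) = mB p (f a) (f b)

/-! ## Replicated varieties -/

/-- The three operations obtained from one binary product `f`:
`dashv` is `f_{1}`, `vdash` is `f_{2}`, `perp` is `f_{1,2}`. -/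
inductive TriOp : Type
  | dashv
  | vdash
  | perp

/-- The two operations obtained from one binary product `f`:
`dashv` is `f_{1}`, `vdash` is `f_{2}`. -/
inductive DiOp : Type
  | dashv
  | vdash

open Classical in
/-- The monomial `u_H`: the leaves from `H` are emphasized, and a node gets the label `f_Q`, where `Q`
is the set of those of its two branches that contain emphasized leaves, or `f_{1}` if `Q` is empty. -/
def triTree (H : Finset ℕ) : FreeMagma ℕ → OpTree TriOp ℕ
  | .of i => .leaf i
  | .mul s t =>
    .node
      (if ∃ i ∈ leaves t, i ∈ H then
        if ∃ i ∈ leaves s, i ∈ H then .perp else .vdash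
      else .dashv)
      (triTree H s) (triTree H t)

open Classical in
/-- The monomial `u_{i}` with a single emphasized leaf `i`: a node gets the label `vdash` if `i` is in
its second branch, and `dashv` otherwise. (In a polylinear monomial `i` is in at most one branch.) -/
def diTree (i : ℕ) : FreeMagma ℕ → OpTree DiOp ℕ
  | .of j => .leaf j
  | .mul s t => .node (if i ∈ leaves t then .vdash else .dashv) (diTree i s) (diTree i t)

/-- The polynomial `Φ_H`. -/
def triPoly {k : Type u} [Field k] (H : Finset ℕ) (Φ : Alg k ℕ) :
    OpTree TriOp ℕ →₀ k :=
  Φ.coeff.mapDomain (triTree H)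

/-- The polynomial `Φ_{i}`. -/
def diPoly {k : Type u} [Field k] (i : ℕ) (Φ : Alg k ℕ) : OpTree DiOp ℕ →₀ k :=
  Φ.coeff.mapDomain (diTree i)

/-- Membership in the variety `tri-Var`, where `Var` is defined by the polylinear identities `S`. -/
def InTriVar {k : Type u} [Field k] (S : Set (Alg k ℕ)) {A : Type w} [AddCommGroup A] [Module k A]
    (m : Ops TriOp k A) : Prop :=
  (∀ (p q : TriOp) (a b c : A), m .vdash (m p a b) c = m .vdash (m q a b) c) ∧
  (∀ (p q : TriOp) (a b c : A), m .dashv a (m p b c) = m .dashv a (m q b c)) ∧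
  ∀ Φ ∈ S, ∀ n : ℕ, IsPolylinear n Φ → ∀ H : Finset ℕ, H.Nonempty → H ⊆ Finset.range n →
    Satisfies m (triPoly H Φ)

/-- Membership in the variety `di-Var`, where `Var` is defined by the polylinear identities `S`. -/
def InDiVar {k : Type u} [Field k] (S : Set (Alg k ℕ)) {A : Type w} [AddCommGroup A] [Module k A]
    (m : Ops DiOp k A) : Prop :=
  (∀ (p q : DiOp) (a b c : A), m .vdash (m p a b) c = m .vdash (m q a b) c) ∧
  (∀ (p q : DiOp) (a b c : A), m .dashv a (m p b c) = m .dashv a (m q b c)) ∧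
  ∀ Φ ∈ S, ∀ n : ℕ, IsPolylinear n Φ → ∀ i ∈ Finset.range n, Satisfies m (diPoly i Φ)

/-- `A` with the map `g : X → A` is a free algebra generated by `X` in the variety `tri-Var`
(the universal property is for tri-algebras in the universe `w`). -/
def IsFreeTriVar {k : Type u} [Field k] (S : Set (Alg k ℕ)) {X : Type*} {A : Type*}
    [AddCommGroup A] [Module k A] (m : Ops TriOp k A) (g : X → A) : Prop :=
  InTriVar S m ∧
  ∀ (B : Type w) [AddCommGroup B] [Module k B] (mB : Ops TriOp k B), InTriVar S mB →
    ∀ α : X → B, ∃! χ : A →ₗ[k] B, IsOpHom m mB χ ∧ ∀ x, χ (g x) = α x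

/-- `A` with the map `g : X → A` is a free algebra generated by `X` in the variety `di-Var`
(the universal property is for di-algebras in the universe `w`). -/
def IsFreeDiVar {k : Type u} [Field k] (S : Set (Alg k ℕ)) {X : Type*} {A : Type*}
    [AddCommGroup A] [Module k A] (m : Ops DiOp k A) (g : X → A) : Prop :=
  InDiVar S m ∧
  ∀ (B : Type w) [AddCommGroup B] [Module k B] (mB : Ops DiOp k B), InDiVar S mB →
    ∀ α : X → B, ∃! χ : A →ₗ[k] B, IsOpHom m mB χ ∧ ∀ x, χ (g x) = α x

/-! ## The algebra `F = Var⟨X ∪ Ẋ⟩` -/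

section Dotted

variable {k : Type u} [Field k] (S : Set (Alg k ℕ)) (X : Type v)

/-- `F = Var⟨X ∪ Ẋ⟩`, where `x` is `Sum.inl x` and `ẋ` is `Sum.inr x`. -/
abbrev F : Type (max u v) := FreeVar S (X ⊕ X)

/-- The generator `ẋ` of `F`. -/
def dot (x : X) : F S X := FreeVar.of S (X ⊕ X) (Sum.inr x)

/-- The homomorphism `φ : F → Var⟨X⟩`, `x ↦ x`, `ẋ ↦ x`. -/
def φ : F S X →ₙₐ[k] FreeVar S X :=
  FreeVar.lift (FreeVar.inVar S X) (Sum.elim (FreeVar.of S X) (FreeVar.of S X))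

/-- The embedding `Var⟨X⟩ ⊆ F`, `x ↦ x`. -/
def incl : FreeVar S X →ₙₐ[k] F S X :=
  FreeVar.lift (FreeVar.inVar S (X ⊕ X)) (fun x => FreeVar.of S (X ⊕ X) (Sum.inl x))

theorem φ_incl (a : FreeVar S X) : φ S X (incl S X a) = a := by
  have h : (φ S X).comp (incl S X) = NonUnitalAlgHom.id k (FreeVar S X) :=
    FreeVar.hom_ext fun x => by simp [φ, incl, FreeVar.lift_of]
  exact DFunLike.congr_fun h a

/-- `φ` as a linear endomorphism of `F ⊇ Var⟨X⟩`. -/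
def φF : F S X →ₗ[k] F S X :=
  ((incl S X).comp (φ S X) : F S X →ₙₐ[k] F S X)

/-- The tri-algebra `F⁽³⁾`: `f ⊢ g = φ(f)g`, `f ⊣ g = fφ(g)`, `f ⊥ g = fg`. -/
def triF : Ops TriOp k (F S X)
  | .vdash => (LinearMap.mul k (F S X)).comp (φF S X)
  | .dashv => (LinearMap.mul k (F S X)).compl₂ (φF S X)
  | .perp => LinearMap.mul k (F S X)

/-- The di-algebra `F⁽²⁾`: `f ⊢ g = φ(f)g`, `f ⊣ g = fφ(g)`. -/
def diF : Ops DiOp k (F S X)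
  | .vdash => (LinearMap.mul k (F S X)).comp (φF S X)
  | .dashv => (LinearMap.mul k (F S X)).compl₂ (φF S X)

/-- The monomial of `F` given by a nonassociative word in `X ∪ Ẋ`. -/
def monomial (t : FreeMagma (X ⊕ X)) : F S X := FreeMagma.lift (FreeVar.of S (X ⊕ X)) t

/-- The degree of a word with respect to the letters from `Ẋ`. -/
def dotDegree {X : Type v} (t : FreeMagma (X ⊕ X)) : ℕ := (leaves t).countP (fun y => y.isRight)

/-- The subalgebra of `F⁽³⁾` generated by `Ẋ`. -/
def triV : Submodule k (F S X) := generated (triF S X) (Set.range (dot S X))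

/-- The subalgebra of `F⁽²⁾` generated by `Ẋ`. -/
def diV : Submodule k (F S X) := generated (diF S X) (Set.range (dot S X))

/-- The operations `⊢`, `⊣`, `⊥` on the subalgebra generated by `Ẋ`. -/
def triVOps : Ops TriOp k (triV S X) := generatedOps (triF S X) (Set.range (dot S X))

/-- The operations `⊢`, `⊣` on the subalgebra generated by `Ẋ`. -/
def diVOps : Ops DiOp k (diV S X) := generatedOps (diF S X) (Set.range (dot S X))

/-- The generator `ẋ` as an element of the generated subalgebra of `F⁽³⁾`. -/
def triDot (x : X) : triV S X := ⟨dot S X x, subset_generated _ _ ⟨x, rfl⟩⟩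

/-- The generator `ẋ` as an element of the generated subalgebra of `F⁽²⁾`. -/
def diDot (x : X) : diV S X := ⟨dot S X x, subset_generated _ _ ⟨x, rfl⟩⟩

end Dotted

end

end Replication

open Replication

/-!
The proof reduces the universal property of the replicated varieties to that of `F = Var⟨X ∪ Ẋ⟩`.

That the subalgebra lies in the replicated variety comes from the endomorphism `φ` of `F`: a word
with emphasized letters from `H ≠ ∅` has in `F` the value of the original word at the arguments to
which `φ` is applied at all letters outside `H` (`eval_emphTree_eq_lift`), so `Φ_H` takes a value
of `Φ`, which is zero because `F ∈ Var` (`inRepVar_of_endomorphism`).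

For the universal property, let `B` be a replicated algebra. Identifying all its products yields a
quotient `B ⧸ collapse m`, which by the bar identities acts on `B` from the left by `⊢` and from the
right by `⊣`. The split extension `(B ⧸ collapse m) × B`, in which the ideal `B` is multiplied by
`⊥` for tri-algebras and by zero for di-algebras, belongs to `Var` (`InRepVar.splitExt`). Indeed, by
polylinearity `Φ` need only be evaluated at arguments from one of the two summands, and if those
from `B` are at the positions `H`, the value of `Φ` is that of `Φ_H`; for `H = ∅` it is the class of
any `Φ_{i}`, and for zero multiplication on `B` the words vanish if `H` has two elements. Hence
`x ↦ (α x, 0)`, `ẋ ↦ (0, α x)` extends to a homomorphism `ψ` from `F`. On the subalgebra generated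
by `Ẋ` it takes values in `B`, and there `ψ (φ f)` is the class of `ψ f`, which makes `ψ` compatible
with the operations (`existsUnique_hom`).

The description of the subalgebra as a span (`generated_eq_span`) uses that each word without dots
is the image under `φ` of an element of the subalgebra. Both cases are treated together: the
operation symbols are given by a function `lab`, and the two varieties differ in `lab` and in the
sets `H` that are allowed (`inTriVar_iff`, `inDiVar_iff`).
-/

namespace Replication

/-! ### Evaluation of polylinear polynomials -/

section Evaluation

variable {k : Type u} [Field k] {A : Type w} [NonUnitalNonAssocRing A] [Module k A]
  [IsScalarTower k A A] [SMulCommClass k A A]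

theorem lift_eq_linearCombination {X : Type v} (c : X → A) (Φ : Alg k X) :
    FreeNonUnitalNonAssocAlgebra.lift k c Φ =
      Finsupp.linearCombination k (fun t => FreeMagma.lift c t) Φ.coeff := rfl

theorem linearCombination_eq_map_lift {X : Type v} {B : Type*} [AddCommGroup B] [Module k B]
    (g : A →ₗ[k] B) (c : X → A) (Φ : Alg k X) (e : FreeMagma X → B)
    (h : ∀ t ∈ Φ.coeff.support, e t = g (FreeMagma.lift c t)) :
    Finsupp.linearCombination k e Φ.coeff = g (FreeNonUnitalNonAssocAlgebra.lift k c Φ) := by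
  rw [lift_eq_linearCombination, Finsupp.linearCombination_apply, Finsupp.linearCombination_apply,
    Finsupp.sum, Finsupp.sum, map_sum]
  exact Finset.sum_congr rfl fun t ht => by rw [map_smul, h t ht]

theorem lift_congr_leaves {X : Type v} {c c' : X → A} :
    ∀ t : FreeMagma X, (∀ i ∈ leaves t, c i = c' i) → FreeMagma.lift c t = FreeMagma.lift c' t
  | .of i, h => h i (Multiset.mem_singleton_self i)
  | .mul s t, h => by
    change FreeMagma.lift c s * FreeMagma.lift c t = FreeMagma.lift c' s * FreeMagma.lift c' t
    rw [lift_congr_leaves s fun i hi => h i (Multiset.mem_add.2 (.inl hi)),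
      lift_congr_leaves t fun i hi => h i (Multiset.mem_add.2 (.inr hi))]

theorem lift_update_add (c : ℕ → A) (i : ℕ) (x y : A) :
    ∀ t : FreeMagma ℕ, (leaves t).count i = 1 →
      FreeMagma.lift (Function.update c i (x + y)) t =
        FreeMagma.lift (Function.update c i x) t + FreeMagma.lift (Function.update c i y) t
  | .of j, h => by
    have hj : i = j := by
      by_contra hne
      simp [leaves, hne] at h
    subst hj
    change Function.update c i (x + y) i = Function.update c i x i + Function.update c i y i
    simp
  | .mul s t, h => by
    have h' : (leaves s).count i + (leaves t).count i = 1 := by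
      rw [← Multiset.count_add]; exact h
    have const (r : FreeMagma ℕ) (hr : (leaves r).count i = 0) (z z' : A) :
        FreeMagma.lift (Function.update c i z) r = FreeMagma.lift (Function.update c i z') r :=
      lift_congr_leaves r fun j hj => by
        have hne : j ≠ i := fun e => Multiset.count_eq_zero.1 hr (e ▸ hj)
        simp [hne]
    change FreeMagma.lift (Function.update c i (x + y)) s *
        FreeMagma.lift (Function.update c i (x + y)) t =
      FreeMagma.lift (Function.update c i x) s * FreeMagma.lift (Function.update c i x) t +
        FreeMagma.lift (Function.update c i y) s * FreeMagma.lift (Function.update c i y) t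
    rcases Nat.eq_zero_or_pos ((leaves s).count i) with hs | hs
    · rw [lift_update_add c i x y t (by omega), mul_add, const s hs (x + y) x, const s hs y x]
    · have ht : (leaves t).count i = 0 := by omega
      rw [lift_update_add c i x y s (by omega), add_mul, const t ht (x + y) x, const t ht y x]

theorem IsPolylinear.lift_congr {n : ℕ} {Φ : Alg k ℕ} (hΦ : IsPolylinear n Φ) {c c' : ℕ → A}
    (h : ∀ i < n, c i = c' i) : FreeNonUnitalNonAssocAlgebra.lift k c Φ =
      FreeNonUnitalNonAssocAlgebra.lift k c' Φ := by
  rw [lift_eq_linearCombination]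
  refine linearCombination_eq_map_lift LinearMap.id c' Φ _ fun t ht => ?_
  refine lift_congr_leaves t fun i hi => h i ?_
  rwa [hΦ t ht, Multiset.mem_range] at hi

/-- A polylinear polynomial vanishes identically once it vanishes on a set `P` of arguments each
element of the algebra is a sum of two of. -/
theorem IsPolylinear.lift_eq_zero {n : ℕ} {Φ : Alg k ℕ} (hΦ : IsPolylinear n Φ) (P : Set A)
    (hP : ∀ z : A, ∃ x ∈ P, ∃ y ∈ P, z = x + y)
    (h : ∀ c : ℕ → A, (∀ i < n, c i ∈ P) → FreeNonUnitalNonAssocAlgebra.lift k c Φ = 0)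
    (c : ℕ → A) : FreeNonUnitalNonAssocAlgebra.lift k c Φ = 0 := by
  suffices H : ∀ m ≤ n, ∀ c : ℕ → A, (∀ i < n, m ≤ i → c i ∈ P) →
      FreeNonUnitalNonAssocAlgebra.lift k c Φ = 0 from
    H n le_rfl c fun i hi hi' => absurd hi (by omega)
  intro m
  induction m with
  | zero => exact fun _ c hc => h c fun i hi => hc i hi (Nat.zero_le i)
  | succ m ih =>
    intro hm c hc
    obtain ⟨x, hx, y, hy, hxy⟩ := hP (c m)
    have hmem (z : A) (hz : z ∈ P) (i : ℕ) (hi : i < n) (hmi : m ≤ i) :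
        Function.update c m z i ∈ P := by
      rcases eq_or_ne i m with rfl | hne
      · simpa using hz
      · simpa [hne] using hc i hi (by omega)
    have hsum : FreeNonUnitalNonAssocAlgebra.lift k c Φ =
        FreeNonUnitalNonAssocAlgebra.lift k (Function.update c m x) Φ +
          FreeNonUnitalNonAssocAlgebra.lift k (Function.update c m y) Φ := by
      simp only [lift_eq_linearCombination, Finsupp.linearCombination_apply, Finsupp.sum]
      rw [← Finset.sum_add_distrib]
      refine Finset.sum_congr rfl fun t ht => ?_
      have hcount : (leaves t).count m = 1 := by
        rw [hΦ t ht]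
        exact Multiset.count_eq_one_of_mem (Multiset.nodup_range n) (Multiset.mem_range.2 hm)
      rw [← smul_add, ← lift_update_add c m x y t hcount, ← hxy, Function.update_eq_self]
    rw [hsum, ih (by omega) _ (hmem x hx), ih (by omega) _ (hmem y hy), add_zero]

end Evaluation

/-! ### Words with emphasized letters -/

section EmphTree

variable {ι : Type}

/-- The word obtained from a nonassociative word by emphasizing the letters from `H`. The operation
symbol of a node is `lab p q`, where `p` and `q` say whether the left and the right branch contain
emphasized letters. Both `triTree` and `diTree` are of this form. -/
def emphTree (lab : Prop → Prop → ι) (H : Finset ℕ) : FreeMagma ℕ → OpTree ι ℕ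
  | .of i => .leaf i
  | .mul s t => .node (lab (∃ i ∈ leaves s, i ∈ H) (∃ i ∈ leaves t, i ∈ H))
      (emphTree lab H s) (emphTree lab H t)

/-- Membership in the variety of algebras with operations indexed by `ι` obtained by replicating
`S`, where the sets of emphasized letters are restricted to those satisfying `adm`. Both `InTriVar`
and `InDiVar` are of this form. -/
structure InRepVar {k : Type u} [Field k] (S : Set (Alg k ℕ)) (lab : Prop → Prop → ι)
    (adm : Finset ℕ → Prop) {A : Type w} [AddCommGroup A] [Module k A] (m : Ops ι k A) : Prop where
  left_bar : ∀ (p q : ι) (a b c : A),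
    m (lab False True) (m p a b) c = m (lab False True) (m q a b) c
  right_bar : ∀ (p q : ι) (a b c : A),
    m (lab True False) a (m p b c) = m (lab True False) a (m q b c)
  satisfies : ∀ Φ ∈ S, ∀ n : ℕ, IsPolylinear n Φ → ∀ H : Finset ℕ, adm H → H ⊆ Finset.range n →
    Satisfies m (Φ.coeff.mapDomain (emphTree lab H))

theorem leaves_ne_zero {X : Type v} : ∀ t : FreeMagma X, leaves t ≠ 0
  | .of _ => Multiset.singleton_ne_zero _
  | .mul s t => fun h => leaves_ne_zero s (add_eq_zero.1 (show leaves s + leaves t = 0 from h)).1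

theorem exists_mem_leaves_mul {H : Finset ℕ} {s t : FreeMagma ℕ} :
    (∃ i ∈ leaves (.mul s t), i ∈ H) ↔ (∃ i ∈ leaves s, i ∈ H) ∨ ∃ i ∈ leaves t, i ∈ H := by
  simp only [leaves, Multiset.mem_add, or_and_right, exists_or]

theorem countP_leaves_mul (H : Finset ℕ) (s t : FreeMagma ℕ) :
    (leaves (.mul s t)).countP (· ∈ H) =
      (leaves s).countP (· ∈ H) + (leaves t).countP (· ∈ H) :=
  Multiset.countP_add _ _ _

theorem countP_leaves_pos {H : Finset ℕ} {t : FreeMagma ℕ} :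
    0 < (leaves t).countP (· ∈ H) ↔ ∃ i ∈ leaves t, i ∈ H :=
  Multiset.countP_pos

theorem IsPolylinear.countP_leaves {k : Type u} [Field k] {n : ℕ} {Φ : Alg k ℕ}
    (hΦ : IsPolylinear n Φ) {H : Finset ℕ} (hH : H ⊆ Finset.range n) {t : FreeMagma ℕ}
    (ht : t ∈ Φ.coeff.support) : (leaves t).countP (· ∈ H) = H.card := by
  have h : (Finset.range n).filter (· ∈ H) = H := by
    ext i
    simp only [Finset.mem_filter, and_iff_right_iff_imp]
    exact fun hi => hH hi
  rw [hΦ t ht, Multiset.countP_eq_card_filter, ← congrArg Finset.card h]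
  rfl

theorem satisfies_mapDomain_iff {k : Type u} [Field k] {A : Type w} [AddCommGroup A] [Module k A]
    (m : Ops ι k A) (T : FreeMagma ℕ → OpTree ι ℕ) (Φ : Alg k ℕ) :
    Satisfies m (Φ.coeff.mapDomain T) ↔
      ∀ a : ℕ → A, Finsupp.linearCombination k (fun t => (T t).eval m a) Φ.coeff = 0 := by
  simp only [Satisfies, Finsupp.linearCombination_mapDomain]
  rfl

end EmphTree

/-! ### The replication of an algebra with an endomorphism -/

section Endomorphism

variable {ι : Type} {k : Type u} [Field k] {A : Type w} [NonUnitalNonAssocRing A] [Module k A]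
  (lab : Prop → Prop → ι) (m : Ops ι k A)
  (e : A →ₙₐ[k] A)

theorem map_eval_emphTree (he : ∀ p f g, e (m p f g) = e f * e g) (H : Finset ℕ) (a : ℕ → A) :
    ∀ t : FreeMagma ℕ,
      e ((emphTree lab H t).eval m a) = FreeMagma.lift (fun i => e (a i)) t
  | .of _ => rfl
  | .mul s t => by
    change e (m _ ((emphTree lab H s).eval m a) ((emphTree lab H t).eval m a)) =
      FreeMagma.lift (fun i => e (a i)) s * FreeMagma.lift (fun i => e (a i)) t
    rw [he, map_eval_emphTree he H a s, map_eval_emphTree he H a t]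

open Classical in
/-- If some letter of the word is emphasized, then its value is the value of the original word at
the arguments to which `e` is applied at all letters that are not emphasized. -/
theorem eval_emphTree_eq_lift (he : ∀ p f g, e (m p f g) = e f * e g)
    (hd : ∀ f g, m (lab True False) f g = f * e g) (hv : ∀ f g, m (lab False True) f g = e f * g)
    (H : Finset ℕ) (a : ℕ → A) :
    ∀ t : FreeMagma ℕ, (∃ i ∈ leaves t, i ∈ H) →
      ((∀ f g, m (lab True True) f g = f * g) ∨ (leaves t).countP (· ∈ H) ≤ 1) →
      (emphTree lab H t).eval m a = FreeMagma.lift (fun i => if i ∈ H then a i else e (a i)) t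
  | .of i, h, _ => by
    have hi : i ∈ H := by simpa [leaves] using h
    change a i = if i ∈ H then a i else e (a i)
    rw [if_pos hi]
  | .mul s t, h, hp => by
    have unmarked (r : FreeMagma ℕ) (hr : ¬ ∃ i ∈ leaves r, i ∈ H) :
        e ((emphTree lab H r).eval m a) =
          FreeMagma.lift (fun i => if i ∈ H then a i else e (a i)) r := by
      rw [map_eval_emphTree lab m e he]
      refine lift_congr_leaves r fun i hi => ?_
      rw [if_neg fun hiH => hr ⟨i, hi, hiH⟩]
    change m (lab (∃ i ∈ leaves s, i ∈ H) (∃ i ∈ leaves t, i ∈ H))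
        ((emphTree lab H s).eval m a) ((emphTree lab H t).eval m a) =
      FreeMagma.lift (fun i => if i ∈ H then a i else e (a i)) s *
        FreeMagma.lift (fun i => if i ∈ H then a i else e (a i)) t
    rw [countP_leaves_mul] at hp
    have ps := @countP_leaves_pos H s
    have pt := @countP_leaves_pos H t
    by_cases hs : ∃ i ∈ leaves s, i ∈ H <;> by_cases ht : ∃ i ∈ leaves t, i ∈ H
    · have hp' := hp.resolve_right (by have := ps.2 hs; have := pt.2 ht; omega)
      rw [eq_true hs, eq_true ht, hp', eval_emphTree_eq_lift he hd hv H a s hs (.inl hp'),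
        eval_emphTree_eq_lift he hd hv H a t ht (.inl hp')]
    · rw [eq_true hs, eq_false ht, hd, unmarked t ht,
        eval_emphTree_eq_lift he hd hv H a s hs (hp.imp_right fun _ => by omega)]
    · rw [eq_false hs, eq_true ht, hv, unmarked s hs,
        eval_emphTree_eq_lift he hd hv H a t ht (hp.imp_right fun _ => by omega)]
    · exact absurd (exists_mem_leaves_mul.1 h) (not_or.2 ⟨hs, ht⟩)

theorem inRepVar_of_endomorphism [IsScalarTower k A A] [SMulCommClass k A A] {S : Set (Alg k ℕ)}
    (hA : InVar S A) {adm : Finset ℕ → Prop}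
    (he : ∀ p f g, e (m p f g) = e f * e g) (hd : ∀ f g, m (lab True False) f g = f * e g)
    (hv : ∀ f g, m (lab False True) f g = e f * g) (hadm : ∀ H, adm H → H.Nonempty)
    (hp : (∀ f g, m (lab True True) f g = f * g) ∨ ∀ H, adm H → H.card ≤ 1) :
    InRepVar S lab adm m where
  left_bar p q a b c := by rw [hv, hv, he, he]
  right_bar p q a b c := by rw [hd, hd, he, he]
  satisfies Φ hS n hΦ H hH hHn := by
    classical
    rw [satisfies_mapDomain_iff]
    intro a
    have hcount {t} := hΦ.countP_leaves hHn (t := t)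
    rw [linearCombination_eq_map_lift LinearMap.id
      (fun i => if i ∈ H then a i else e (a i)) Φ _ fun t ht => ?_, hA Φ hS, map_zero]
    refine eval_emphTree_eq_lift lab m e he hd hv H a t ?_ (hp.imp_right fun h => ?_)
    · rw [← countP_leaves_pos, hcount ht]
      exact (hadm H hH).card_pos
    · exact (hcount ht).trans_le (h H hH)

end Endomorphism

/-! ### Generated subalgebras -/

section Generated

variable {ι : Type} {k : Type u} [Field k] {A : Type w} [AddCommGroup A] [Module k A]
  (m : Ops ι k A) (s : Set A)

theorem generated_le {W : Submodule k A} (hs : s ⊆ W)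
    (hW : ∀ p, ∀ a ∈ W, ∀ b ∈ W, m p a b ∈ W) : generated m s ≤ W :=
  sInf_le ⟨hs, hW⟩

theorem coe_eval_generatedOps {X : Type*} (a : X → generated m s) :
    ∀ t : OpTree ι X, ((t.eval (generatedOps m s) a : generated m s) : A) = t.eval m (fun x => (a x : A))
  | .leaf _ => rfl
  | .node p t t' => by
    change m p ((t.eval (generatedOps m s) a : generated m s) : A)
      ((t'.eval (generatedOps m s) a : generated m s) : A) = _
    rw [coe_eval_generatedOps a t, coe_eval_generatedOps a t']
    rfl

theorem InRepVar.generated {S : Set (Alg k ℕ)} {lab : Prop → Prop → ι} {adm : Finset ℕ → Prop}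
    (h : InRepVar S lab adm m) : InRepVar S lab adm (generatedOps m s) where
  left_bar p q a b c := Subtype.ext (h.left_bar p q a b c)
  right_bar p q a b c := Subtype.ext (h.right_bar p q a b c)
  satisfies Φ hS n hΦ H hH hHn a := by
    have h0 := h.satisfies Φ hS n hΦ H hH hHn fun i => (a i : A)
    refine Subtype.ext ?_
    rw [← Submodule.subtype_apply, Finsupp.apply_linearCombination]
    rw [show ((Replication.generated m s).subtype ∘ OpTree.eval (generatedOps m s) a) =
      OpTree.eval m fun i => (a i : A) from funext (coe_eval_generatedOps m s a), h0]
    rfl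

/-- Homomorphisms from a generated subalgebra are determined by their values at the generators. -/
theorem IsOpHom.eq_of_eqOn {B : Type*} [AddCommGroup B] [Module k B] {mB : Ops ι k B}
    {χ χ' : Replication.generated m s →ₗ[k] B} (h : IsOpHom (generatedOps m s) mB χ)
    (h' : IsOpHom (generatedOps m s) mB χ')
    (hs : ∀ a (ha : a ∈ s), χ ⟨a, subset_generated m s ha⟩ = χ' ⟨a, subset_generated m s ha⟩) :
    χ = χ' := by
  have hle : Replication.generated m s ≤
      (LinearMap.eqLocus χ χ').map (Replication.generated m s).subtype := by
    refine generated_le m s (fun a ha => ⟨_, hs a ha, rfl⟩) ?_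
    rintro p _ ⟨a, ha, rfl⟩ _ ⟨b, hb, rfl⟩
    refine ⟨generatedOps m s p a b, ?_, rfl⟩
    change χ _ = χ' _
    rw [h, h', show χ a = χ' a from ha, show χ b = χ' b from hb]
  ext a
  obtain ⟨b, hb, hba⟩ := hle a.2
  rw [← show b = a from Subtype.ext hba]
  exact hb

end Generated

/-! ### The split extension of the collapsed algebra -/

section Collapse

variable {ι : Type} {k : Type u} [Field k] {B : Type w} [AddCommGroup B] [Module k B]

/-- The span of all differences of products `a * b` with different operations. -/
def collapse (m : Ops ι k B) : Submodule k B :=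
  Submodule.span k {x | ∃ p q a b, x = m p a b - m q a b}

theorem mkQ_collapse (m : Ops ι k B) (p q : ι) (a b : B) :
    (collapse m).mkQ (m p a b) = (collapse m).mkQ (m q a b) :=
  (Submodule.Quotient.eq _).2 (Submodule.subset_span ⟨p, q, a, b, rfl⟩)

/-- The bar identities for the operations `d` and `v`, in the roles of `⊣` and `⊢`. -/
structure IsBar (m : Ops ι k B) (d v : ι) : Prop where
  left : ∀ (p q : ι) (a b c : B), m v (m p a b) c = m v (m q a b) c
  right : ∀ (p q : ι) (a b c : B), m d a (m p b c) = m d a (m q b c)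

namespace IsBar

variable {m : Ops ι k B} {d v : ι} (h : IsBar m d v)

/-- The left action of `B ⧸ collapse m` on `B` induced by `⊢`. -/
def leftAct : (B ⧸ collapse m) →ₗ[k] B →ₗ[k] B :=
  (collapse m).liftQ (m v) (Submodule.span_le.2 (by
    rintro _ ⟨p, q, a, b, rfl⟩
    refine LinearMap.mem_ker.2 (LinearMap.ext fun c => ?_)
    rw [map_sub, LinearMap.sub_apply, h.left p q a b c, sub_self, LinearMap.zero_apply]))

/-- The right action of `B ⧸ collapse m` on `B` induced by `⊣`, with the arguments swapped. -/
def rightAct : (B ⧸ collapse m) →ₗ[k] B →ₗ[k] B :=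
  (collapse m).liftQ (m d).flip (Submodule.span_le.2 (by
    rintro _ ⟨p, q, b, c, rfl⟩
    refine LinearMap.mem_ker.2 (LinearMap.ext fun a => ?_)
    rw [map_sub, LinearMap.sub_apply, LinearMap.flip_apply, LinearMap.flip_apply,
      h.right p q a b c, sub_self, LinearMap.zero_apply]))

theorem mkQ_leftAct (x : B ⧸ collapse m) (b : B) (hb : b ∈ collapse m) :
    (collapse m).mkQ (h.leftAct x b) = 0 := by
  obtain ⟨a, rfl⟩ := (collapse m).mkQ_surjective x
  change (collapse m).mkQ (m v a b) = 0
  rw [mkQ_collapse m v d]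
  have : collapse m ≤ LinearMap.ker (m d a) := Submodule.span_le.2 (by
    rintro _ ⟨p, q, b, c, rfl⟩
    refine LinearMap.mem_ker.2 ?_
    rw [map_sub, h.right p q a b c, sub_self])
  rw [LinearMap.mem_ker.1 (this hb), map_zero]

/-- The product of `B ⧸ collapse m` induced by any of the operations. -/
def quotMul : (B ⧸ collapse m) →ₗ[k] (B ⧸ collapse m) →ₗ[k] (B ⧸ collapse m) :=
  LinearMap.flip ((collapse m).liftQ
    (LinearMap.flip (h.leftAct.compr₂ (collapse m).mkQ))
    (fun b hb => LinearMap.mem_ker.2 (LinearMap.ext fun x => h.mkQ_leftAct x b hb)))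

/-- The space `(B ⧸ collapse m) × B` with the product
`(x, a) (y, b) = (x y, x ⊢ b + a ⊣ y + P a b)`. -/
def SplitExt (_ : IsBar m d v) (_ : B →ₗ[k] B →ₗ[k] B) : Type w := (B ⧸ collapse m) × B

namespace SplitExt

variable {P : B →ₗ[k] B →ₗ[k] B}

instance : AddCommGroup (h.SplitExt P) := inferInstanceAs (AddCommGroup ((B ⧸ collapse m) × B))

instance : Module k (h.SplitExt P) := inferInstanceAs (Module k ((B ⧸ collapse m) × B))

variable (P)

/-- The embedding of `B ⧸ collapse m`. -/
def inl : (B ⧸ collapse m) →ₗ[k] h.SplitExt P := LinearMap.inl k _ _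

/-- The embedding of `B` as an ideal. -/
def inr : B →ₗ[k] h.SplitExt P := LinearMap.inr k _ _

/-- The projection onto `B ⧸ collapse m`. -/
def fst : h.SplitExt P →ₗ[k] (B ⧸ collapse m) := LinearMap.fst k _ _

/-- The projection onto the ideal `B`. -/
def snd : h.SplitExt P →ₗ[k] B := LinearMap.snd k _ _

/-- The product as a bilinear map. -/
def mulMap : h.SplitExt P →ₗ[k] h.SplitExt P →ₗ[k] h.SplitExt P :=
  (h.quotMul.compl₁₂ (fst h P) (fst h P)).compr₂ (inl h P) +
    (h.leftAct.compl₁₂ (fst h P) (snd h P) + (h.rightAct.compl₁₂ (fst h P) (snd h P)).flip +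
      P.compl₁₂ (snd h P) (snd h P)).compr₂ (inr h P)

instance : NonUnitalNonAssocRing (h.SplitExt P) :=
  { (inferInstance : AddCommGroup (h.SplitExt P)) with
    mul := fun a b => mulMap h P a b
    left_distrib := fun a b c => map_add (mulMap h P a) b c
    right_distrib := fun a b c => LinearMap.congr_fun (map_add (mulMap h P) a b) c
    zero_mul := fun a => LinearMap.congr_fun (map_zero (mulMap h P)) a
    mul_zero := fun a => map_zero (mulMap h P a) }

instance : IsScalarTower k (h.SplitExt P) (h.SplitExt P) :=
  ⟨fun r a b => LinearMap.congr_fun (map_smul (mulMap h P) r a) b⟩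

instance : SMulCommClass k (h.SplitExt P) (h.SplitExt P) :=
  ⟨fun r a b => (map_smul (mulMap h P a) r b).symm⟩

theorem exists_eq_add (z : h.SplitExt P) :
    ∃ a b, z = inl h P ((collapse m).mkQ a) + inr h P b := by
  obtain ⟨a, ha⟩ := (collapse m).mkQ_surjective z.1
  refine ⟨a, z.2, Prod.ext ?_ ?_⟩
  · exact ((add_zero _).trans ha).symm
  · exact (zero_add _).symm

theorem mul_def (z z' : h.SplitExt P) : z * z' = inl h P (h.quotMul z.1 z'.1) +
    inr h P (h.leftAct z.1 z'.2 + h.rightAct z'.1 z.2 + P z.2 z'.2) := rfl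

theorem inl_mul_inl (p : ι) (a b : B) :
    inl h P ((collapse m).mkQ a) * inl h P ((collapse m).mkQ b) =
      inl h P ((collapse m).mkQ (m p a b)) := by
  rw [mkQ_collapse m p v, mul_def]
  change inl h P ((collapse m).mkQ (m v a b)) + inr h P (m v a 0 + m d 0 b + P 0 0) = _
  simp

theorem inl_mul_inr (a b : B) :
    inl h P ((collapse m).mkQ a) * inr h P b = inr h P (m v a b) := by
  rw [mul_def]
  change inl h P (h.quotMul ((collapse m).mkQ a) 0) +
    inr h P (m v a b + h.rightAct 0 0 + P 0 b) = _
  simp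

theorem inr_mul_inl (a b : B) :
    inr h P a * inl h P ((collapse m).mkQ b) = inr h P (m d a b) := by
  rw [mul_def]
  change inl h P (h.quotMul 0 ((collapse m).mkQ b)) +
    inr h P (h.leftAct 0 0 + m d a b + P a 0) = _
  simp

theorem inr_mul_inr (a b : B) : inr h P a * inr h P b = inr h P (P a b) := by
  rw [mul_def]
  change inl h P (h.quotMul 0 0) + inr h P (h.leftAct 0 b + h.rightAct 0 a + P a b) = _
  simp

theorem snd_inr (b : B) : snd h P (inr h P b) = b := rfl

end SplitExt

end IsBar

end Collapse

/-! ### The split extension belongs to the original variety -/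

section SplitExtInVar

open IsBar SplitExt

variable {ι : Type} {k : Type u} [Field k] {B : Type w} [AddCommGroup B] [Module k B]
  {m : Ops ι k B} {lab : Prop → Prop → ι} (h : IsBar m (lab True False) (lab False True))
  (P : B →ₗ[k] B →ₗ[k] B)

theorem lift_eq_inl (a : ℕ → B) (H H' : Finset ℕ) (c : ℕ → h.SplitExt P)
    (hc : ∀ i ∉ H, c i = inl h P ((collapse m).mkQ (a i))) :
    ∀ t : FreeMagma ℕ, (¬ ∃ i ∈ leaves t, i ∈ H) →
      FreeMagma.lift c t = inl h P ((collapse m).mkQ ((emphTree lab H' t).eval m a))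
  | .of i, ht => hc i fun hi => ht ⟨i, Multiset.mem_singleton_self i, hi⟩
  | .mul s t, ht => by
    rw [exists_mem_leaves_mul, not_or] at ht
    change FreeMagma.lift c s * FreeMagma.lift c t =
      inl h P ((collapse m).mkQ (m _ ((emphTree lab H' s).eval m a) ((emphTree lab H' t).eval m a)))
    rw [lift_eq_inl a H H' c hc s ht.1, lift_eq_inl a H H' c hc t ht.2, inl_mul_inl]

/-- If the arguments at the letters from `H` lie in the ideal `B` and all other arguments in
`B ⧸ collapse m`, then the value of a word with a letter from `H` is the value in `B` of the word
with emphasized letters `H`. -/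
theorem lift_eq_inr (a : ℕ → B) (H : Finset ℕ) (c : ℕ → h.SplitExt P)
    (hc : ∀ i ∉ H, c i = inl h P ((collapse m).mkQ (a i))) (hc' : ∀ i ∈ H, c i = inr h P (a i)) :
    ∀ t : FreeMagma ℕ, (∃ i ∈ leaves t, i ∈ H) →
      (P = m (lab True True) ∨ (leaves t).countP (· ∈ H) ≤ 1) →
      FreeMagma.lift c t = inr h P ((emphTree lab H t).eval m a)
  | .of i, ht, _ => hc' i (by simpa [leaves] using ht)
  | .mul s t, hst, hp => by
    change FreeMagma.lift c s * FreeMagma.lift c t =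
      inr h P (m (lab (∃ i ∈ leaves s, i ∈ H) (∃ i ∈ leaves t, i ∈ H))
        ((emphTree lab H s).eval m a) ((emphTree lab H t).eval m a))
    rw [countP_leaves_mul] at hp
    have ps := @countP_leaves_pos H s
    have pt := @countP_leaves_pos H t
    by_cases hs : ∃ i ∈ leaves s, i ∈ H <;> by_cases ht : ∃ i ∈ leaves t, i ∈ H
    · have hp' := hp.resolve_right (by have := ps.2 hs; have := pt.2 ht; omega)
      rw [lift_eq_inr a H c hc hc' s hs (.inl hp'), lift_eq_inr a H c hc hc' t ht (.inl hp'),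
        inr_mul_inr, eq_true hs, eq_true ht, ← hp']
    · rw [lift_eq_inr a H c hc hc' s hs (hp.imp_right fun _ => by omega),
        lift_eq_inl h P a H H c hc t ht, inr_mul_inl, eq_true hs, eq_false ht]
    · rw [lift_eq_inr a H c hc hc' t ht (hp.imp_right fun _ => by omega),
        lift_eq_inl h P a H H c hc s hs, inl_mul_inr, eq_false hs, eq_true ht]
    · exact absurd (exists_mem_leaves_mul.1 hst) (not_or.2 ⟨hs, ht⟩)

/-- If the ideal `B` has zero multiplication, then words with at least two arguments from it
vanish. -/
theorem lift_eq_zero_of_two_le (a : ℕ → B) (H : Finset ℕ) (c : ℕ → h.SplitExt 0)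
    (hc : ∀ i ∉ H, c i = inl h 0 ((collapse m).mkQ (a i))) (hc' : ∀ i ∈ H, c i = inr h 0 (a i)) :
    ∀ t : FreeMagma ℕ, 2 ≤ (leaves t).countP (· ∈ H) → FreeMagma.lift c t = 0
  | .of i, ht => by
    have := Multiset.countP_le_card (· ∈ H) (leaves (.of i))
    simp only [leaves, Multiset.card_singleton] at this
    exact absurd (ht.trans this) (by norm_num)
  | .mul s t, hst => by
    change FreeMagma.lift c s * FreeMagma.lift c t = 0
    rw [countP_leaves_mul] at hst
    by_cases hs : 2 ≤ (leaves s).countP (· ∈ H)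
    · rw [lift_eq_zero_of_two_le a H c hc hc' s hs, zero_mul]
    by_cases ht : 2 ≤ (leaves t).countP (· ∈ H)
    · rw [lift_eq_zero_of_two_le a H c hc hc' t ht, mul_zero]
    rw [lift_eq_inr h 0 a H c hc hc' s (countP_leaves_pos.1 (by omega)) (.inr (by omega)),
      lift_eq_inr h 0 a H c hc hc' t (countP_leaves_pos.1 (by omega)) (.inr (by omega)),
      inr_mul_inr]
    simp

/-- The split extension of a replicated algebra belongs to the original variety. Either `P` is the
operation `⊥` and all nonempty sets of emphasized letters are admissible, or `P` is zero and the
singletons are admissible. -/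
theorem InRepVar.splitExt {S : Set (Alg k ℕ)} {adm : Finset ℕ → Prop}
    (hS : ∀ Φ ∈ S, ∃ n, IsPolylinear n Φ) (hB : InRepVar S lab adm m)
    (hadm : ∀ i, adm {i})
    (hP : (P = m (lab True True) ∧ ∀ H : Finset ℕ, H.Nonempty → adm H) ∨ P = 0) :
    InVar S (h.SplitExt P) := by
  classical
  intro Φ hΦS
  obtain ⟨n, hΦ⟩ := hS Φ hΦS
  refine hΦ.lift_eq_zero (Set.range (fun a => inl h P ((collapse m).mkQ a)) ∪ Set.range (inr h P))
    (fun z => ?_) fun c hc => ?_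
  · obtain ⟨a, b, hz⟩ := exists_eq_add h P z
    exact ⟨_, .inl ⟨a, rfl⟩, _, .inr ⟨b, rfl⟩, hz⟩
  -- By polylinearity it suffices to consider arguments in one of the two summands.
  obtain ⟨a, ha⟩ : ∃ a : ℕ → B, ∀ i < n,
      c i = inl h P ((collapse m).mkQ (a i)) ∨ c i = inr h P (a i) := by
    have : ∀ i, ∃ b : B, i < n → c i = inl h P ((collapse m).mkQ b) ∨ c i = inr h P b := by
      intro i
      by_cases hi : i < n
      · rcases hc i hi with ⟨b, hb⟩ | ⟨b, hb⟩
        · exact ⟨b, fun _ => .inl hb.symm⟩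
        · exact ⟨b, fun _ => .inr hb.symm⟩
      · exact ⟨0, fun hi' => absurd hi' hi⟩
    choose a ha using this
    exact ⟨a, ha⟩
  set H : Finset ℕ := {i ∈ Finset.range n | c i = inr h P (a i)} with hHdef
  have hHn : H ⊆ Finset.range n := Finset.filter_subset _ _
  set c' : ℕ → h.SplitExt P :=
    fun i => if i ∈ H then inr h P (a i) else inl h P ((collapse m).mkQ (a i)) with hc'def
  have hcc' : ∀ i < n, c i = c' i := by
    intro i hi
    by_cases hiH : i ∈ H
    · rw [hc'def]
      simp only [hiH, if_true]
      exact (Finset.mem_filter.1 hiH).2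
    · rw [hc'def]
      simp only [hiH, if_false]
      refine (ha i hi).resolve_right fun hr => hiH ?_
      exact Finset.mem_filter.2 ⟨Finset.mem_range.2 hi, hr⟩
  have hc0 : ∀ i ∉ H, c' i = inl h P ((collapse m).mkQ (a i)) := fun i hi => if_neg hi
  have hc1 : ∀ i ∈ H, c' i = inr h P (a i) := fun i hi => if_pos hi
  have hcount {t} := hΦ.countP_leaves hHn (t := t)
  have hsat (H' : Finset ℕ) (hH' : adm H') (hn : H' ⊆ Finset.range n) :=
    (satisfies_mapDomain_iff m (emphTree lab H') Φ).1 (hB.satisfies Φ hΦS n hΦ H' hH' hn) a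
  have key {g : B →ₗ[k] h.SplitExt P} {H' : Finset ℕ} (hH' : adm H') (hn : H' ⊆ Finset.range n)
      (hg : ∀ t ∈ Φ.coeff.support,
        FreeMagma.lift c' t = g ((emphTree lab H' t).eval m a)) :
      FreeNonUnitalNonAssocAlgebra.lift k c' Φ = 0 := by
    have h0 := congrArg g (hsat H' hH' hn)
    rw [Finsupp.apply_linearCombination, map_zero] at h0
    rw [lift_eq_linearCombination, ← h0, Finsupp.linearCombination_apply,
      Finsupp.linearCombination_apply]
    exact Finset.sum_congr rfl fun t ht => congrArg _ (hg t ht)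
  rw [hΦ.lift_congr hcc']
  rcases H.eq_empty_or_nonempty with hH | hH
  · rcases Nat.eq_zero_or_pos n with rfl | hn
    · -- Words have at least one letter, so only the zero polynomial is polylinear of degree `0`.
      rw [lift_eq_linearCombination, Finsupp.linearCombination_apply]
      refine Finset.sum_eq_zero fun t ht => ?_
      exact absurd (hΦ t ht) (leaves_ne_zero t)
    · -- All operations agree in `B ⧸ collapse m`, so any emphasized letter will do.
      refine key (g := (inl h P).comp (collapse m).mkQ) (hadm 0) (by simpa using hn)
        fun t ht => ?_
      refine lift_eq_inl h P a H _ c' hc0 t ?_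
      rw [hH]
      simp
  · have hmeet (t) (ht : t ∈ Φ.coeff.support) : ∃ i ∈ leaves t, i ∈ H := by
      rw [← countP_leaves_pos, hcount ht]
      exact hH.card_pos
    rcases hP with ⟨hP, hall⟩ | rfl
    · exact key (g := inr h P) (hall H hH) hHn fun t ht =>
        lift_eq_inr h P a H c' hc0 hc1 t (hmeet t ht) (.inl hP)
    · by_cases h1 : H.card = 1
      · obtain ⟨i, hi⟩ := Finset.card_eq_one.1 h1
        exact key (g := inr h 0) (hi ▸ hadm i) hHn fun t ht =>
          lift_eq_inr h 0 a H c' hc0 hc1 t (hmeet t ht) (.inr ((hcount ht).trans h1).le)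
      · have h2 : 2 ≤ H.card := by have := hH.card_pos; omega
        rw [lift_eq_linearCombination, Finsupp.linearCombination_apply]
        refine Finset.sum_eq_zero fun t ht => ?_
        dsimp only
        rw [lift_eq_zero_of_two_le h a H c' hc0 hc1 t (h2.trans (hcount ht).ge), smul_zero]

end SplitExtInVar

/-! ### Words in dotted and undotted letters -/

section Words

variable {k : Type u} [Field k] (S : Set (Alg k ℕ)) (X : Type v)

/-- The word with all dots removed. -/
def undot {X : Type v} (t : FreeMagma (X ⊕ X)) : FreeMagma (X ⊕ X) :=
  FreeMagma.lift (fun y => FreeMagma.of (Sum.inl (Sum.elim id id y))) t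

theorem monomial_mul (s t : FreeMagma (X ⊕ X)) :
    monomial S X (.mul s t) = monomial S X s * monomial S X t := rfl

theorem φF_mul (f g : F S X) : φF S X (f * g) = φF S X f * φF S X g :=
  map_mul ((incl S X).comp (φ S X)) f g

theorem φF_of (y : X ⊕ X) : φF S X (FreeVar.of S (X ⊕ X) y) =
    FreeVar.of S (X ⊕ X) (Sum.inl (Sum.elim id id y)) := by
  change incl S X (φ S X (FreeVar.of S (X ⊕ X) y)) = _
  rcases y with x | x <;> simp [φ, incl, FreeVar.lift_of]

theorem φF_φF (f : F S X) : φF S X (φF S X f) = φF S X f :=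
  congrArg (incl S X) (φ_incl S X (φ S X f))

theorem φF_monomial : ∀ t : FreeMagma (X ⊕ X), φF S X (monomial S X t) = monomial S X (undot t)
  | .of y => φF_of S X y
  | .mul s t => by
    rw [monomial_mul, φF_mul, φF_monomial s, φF_monomial t]
    rfl

theorem dotDegree_inl {X : Type v} (x : X) : dotDegree (.of (.inl x)) = 0 := rfl

theorem dotDegree_inr {X : Type v} (x : X) : dotDegree (.of (.inr x)) = 1 := rfl

theorem dotDegree_mul {X : Type v} (s t : FreeMagma (X ⊕ X)) :
    dotDegree (.mul s t) = dotDegree s + dotDegree t :=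
  Multiset.countP_add _ _ _

theorem dotDegree_undot {X : Type v} : ∀ t : FreeMagma (X ⊕ X), dotDegree (undot t) = 0
  | .of _ => dotDegree_inl _
  | .mul s t => by
    change dotDegree (.mul (undot s) (undot t)) = 0
    rw [dotDegree_mul, dotDegree_undot s, dotDegree_undot t]

theorem undot_eq_self {X : Type v} : ∀ t : FreeMagma (X ⊕ X), dotDegree t = 0 → undot t = t
  | .of (.inl _), _ => rfl
  | .of (.inr x), h => absurd (h.symm.trans (dotDegree_inr x)) Nat.zero_ne_one
  | .mul s t, h => by
    rw [dotDegree_mul, Nat.add_eq_zero_iff] at h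
    change FreeMagma.mul (undot s) (undot t) = _
    rw [undot_eq_self s h.1, undot_eq_self t h.2]

variable {ι : Type} {S X} {m : Ops ι k (F S X)}

theorem exists_mem_generated_φF_eq {d : ι} (hd : ∀ f g, m d f g = f * φF S X g) :
    ∀ t : FreeMagma (X ⊕ X), ∃ f ∈ generated m (Set.range (dot S X)),
      φF S X f = monomial S X (undot t)
  | .of y => ⟨dot S X (Sum.elim id id y), subset_generated _ _ ⟨_, rfl⟩, φF_of S X _⟩
  | .mul s t => by
    obtain ⟨f, hf, hfs⟩ := exists_mem_generated_φF_eq hd s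
    obtain ⟨g, hg, hgt⟩ := exists_mem_generated_φF_eq hd t
    refine ⟨m d f g, op_mem_generated _ _ _ hf hg, ?_⟩
    rw [hd, φF_mul, φF_φF, hfs, hgt]
    rfl

/-- The subalgebra generated by `Ẋ` is spanned by the words whose degree in `Ẋ` satisfies `D`. In
the applications `D` is `0 < ·` when the product of `F` is one of the operations, and `· = 1`
otherwise. -/
theorem generated_eq_span {d v : ι} (hd : ∀ f g, m d f g = f * φF S X g)
    (hv : ∀ f g, m v f g = φF S X f * g) (D : ℕ → Prop) (hD1 : D 1) (hD : ∀ n, D n → 0 < n)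
    (hop : ∀ p, p = d ∨ p = v ∨ (∀ f g, m p f g = f * g) ∧ ∀ n, 0 < n → D n)
    (hp : (∃ p, ∀ f g, m p f g = f * g) ∧ (∀ n, 0 < n → D n) ∨ ∀ n, D n → n ≤ 1) :
    generated m (Set.range (dot S X)) =
      Submodule.span k {f | ∃ t, D (dotDegree t) ∧ monomial S X t = f} := by
  refine le_antisymm (generated_le _ _ ?_ ?_) (Submodule.span_le.2 ?_)
  · rintro _ ⟨x, rfl⟩
    exact Submodule.subset_span ⟨.of (.inr x), hD1, rfl⟩
  · intro p a ha b hb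
    refine (Submodule.map₂_le.1 ?_) a ha b hb
    rw [Submodule.map₂_span_span]
    refine Submodule.span_le.2 ?_
    rintro _ ⟨_, ⟨s, hs, rfl⟩, _, ⟨t, ht, rfl⟩, rfl⟩
    rcases hop p with rfl | rfl | ⟨h, hall⟩
    · refine Submodule.subset_span ⟨.mul s (undot t), ?_, ?_⟩
      · rwa [dotDegree_mul, dotDegree_undot, add_zero]
      · change _ = m _ (monomial S X s) (monomial S X t)
        rw [hd, φF_monomial, monomial_mul]
    · refine Submodule.subset_span ⟨.mul (undot s) t, ?_, ?_⟩
      · rwa [dotDegree_mul, dotDegree_undot, zero_add]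
      · change _ = m _ (monomial S X s) (monomial S X t)
        rw [hv, φF_monomial, monomial_mul]
    · refine Submodule.subset_span ⟨.mul s t, hall _ ?_, ?_⟩
      · rw [dotDegree_mul]
        exact Nat.add_pos_left (hD _ hs) _
      · change _ = m _ (monomial S X s) (monomial S X t)
        rw [h, monomial_mul]
  · rintro _ ⟨t, ht, rfl⟩
    change monomial S X t ∈ generated m (Set.range (dot S X))
    induction t with
    | ih1 y =>
      rcases y with x | x
      · exact absurd (hD _ ht) (dotDegree_inl x).not_gt
      · exact subset_generated _ _ ⟨x, rfl⟩
    | ih2 s t ihs iht =>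
      change D (dotDegree (.mul s t)) at ht
      change monomial S X (.mul s t) ∈ _
      rw [dotDegree_mul] at ht
      rw [monomial_mul]
      -- A factor without dots is `φ` of an element of the subalgebra.
      rcases Nat.eq_zero_or_pos (dotDegree s) with hs0 | hs0
      · rw [hs0, zero_add] at ht
        obtain ⟨f, hf, hfs⟩ := exists_mem_generated_φF_eq hd s
        rw [← undot_eq_self s hs0, ← hfs, ← hv]
        exact op_mem_generated _ _ _ hf (iht ht)
      rcases Nat.eq_zero_or_pos (dotDegree t) with ht0 | ht0
      · rw [ht0, add_zero] at ht
        obtain ⟨f, hf, hft⟩ := exists_mem_generated_φF_eq hd t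
        rw [← undot_eq_self t ht0, ← hft, ← hd]
        exact op_mem_generated _ _ _ (ihs ht) hf
      rcases hp with ⟨⟨p, hp⟩, hall⟩ | hle
      · rw [← hp]
        exact op_mem_generated _ _ _ (ihs (hall _ hs0)) (iht (hall _ ht0))
      · have := hle _ ht
        omega

end Words

/-! ### The universal property -/

section Universal

open IsBar SplitExt

variable {k : Type u} [Field k] {S : Set (Alg k ℕ)} {X : Type v} {ι : Type}
  {mF : Ops ι k (F S X)} {d v : ι} {B : Type w} [AddCommGroup B] [Module k B] {mB : Ops ι k B}

/-- The homomorphism `F → (B ⧸ collapse mB) × B` given by `x ↦ (α x, 0)`, `ẋ ↦ (0, α x)` restricts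
to a homomorphism from the subalgebra generated by `Ẋ` to the ideal `B`. -/
theorem existsUnique_hom (hd : ∀ f g, mF d f g = f * φF S X g)
    (hv : ∀ f g, mF v f g = φF S X f * g) (h : IsBar mB d v) (P : B →ₗ[k] B →ₗ[k] B)
    (hP : InVar S (h.SplitExt P))
    (hop : ∀ p, p = d ∨ p = v ∨ (∀ f g, mF p f g = f * g) ∧ mB p = P) (α : X → B) :
    ∃! χ : generated mF (Set.range (dot S X)) →ₗ[k] B,
      IsOpHom (generatedOps mF (Set.range (dot S X))) mB χ ∧
        ∀ x, χ ⟨dot S X x, subset_generated _ _ ⟨x, rfl⟩⟩ = α x := by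
  let ψ : F S X →ₙₐ[k] h.SplitExt P := FreeVar.lift hP
    (Sum.elim (fun x => inl h P ((collapse mB).mkQ (α x))) (fun x => inr h P (α x)))
  have hψl (x : X) : ψ (FreeVar.of S (X ⊕ X) (.inl x)) = inl h P ((collapse mB).mkQ (α x)) :=
    FreeVar.lift_of hP _ _
  have hψr (x : X) : ψ (dot S X x) = inr h P (α x) := FreeVar.lift_of hP _ _
  -- The second component makes the induction work: `φ` corresponds to `b ↦ (b, 0)`.
  let σ : F S X →ₗ[k] B := (snd h P).comp (ψ : F S X →ₗ[k] h.SplitExt P)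
  let W : Submodule k (F S X) :=
    LinearMap.eqLocus (ψ : F S X →ₗ[k] h.SplitExt P) ((inr h P).comp σ) ⊓
      LinearMap.eqLocus ((ψ : F S X →ₗ[k] h.SplitExt P).comp (φF S X))
        ((inl h P).comp ((collapse mB).mkQ.comp σ))
  have mem_W {f : F S X} {b : B} (h1 : ψ f = inr h P b)
      (h2 : ψ (φF S X f) = inl h P ((collapse mB).mkQ b)) : f ∈ W := by
    have hσ : σ f = b := (congrArg (snd h P) h1).trans (snd_inr h P b)
    refine ⟨?_, ?_⟩
    · change ψ f = inr h P (σ f)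
      rw [hσ, h1]
    · change ψ (φF S X f) = inl h P ((collapse mB).mkQ (σ f))
      rw [hσ, h2]
  have hmul : ∀ p, ∀ f ∈ W, ∀ g ∈ W, ψ (mF p f g) = inr h P (mB p (σ f) (σ g)) ∧
      ψ (φF S X (mF p f g)) = inl h P ((collapse mB).mkQ (mB p (σ f) (σ g))) := by
    rintro p f ⟨hf1, hf2⟩ g ⟨hg1, hg2⟩
    change ψ f = inr h P (σ f) at hf1
    change ψ g = inr h P (σ g) at hg1
    change ψ (φF S X f) = inl h P ((collapse mB).mkQ (σ f)) at hf2
    change ψ (φF S X g) = inl h P ((collapse mB).mkQ (σ g)) at hg2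
    rw [← inl_mul_inl h P p, ← hf2, ← hg2, ← map_mul]
    rcases hop p with rfl | rfl | ⟨hp, hp'⟩
    · rw [hd, φF_mul, φF_φF, map_mul, hf1, hg2, inr_mul_inl]
      exact ⟨rfl, rfl⟩
    · rw [hv, φF_mul, φF_φF, map_mul, hf2, hg1, inl_mul_inr]
      exact ⟨rfl, rfl⟩
    · rw [hp, φF_mul, map_mul, hf1, hg1, inr_mul_inr, hp']
      exact ⟨rfl, rfl⟩
  have hle : generated mF (Set.range (dot S X)) ≤ W := by
    refine generated_le _ _ ?_ fun p f hf g hg =>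
      mem_W (hmul p f hf g hg).1 (hmul p f hf g hg).2
    rintro _ ⟨x, rfl⟩
    refine mem_W (hψr x) ?_
    rw [dot, φF_of]
    exact hψl x
  refine ⟨σ.comp (Submodule.subtype _), ⟨fun p f g => ?_, fun x => ?_⟩, fun χ hχ => ?_⟩
  · exact congrArg (snd h P) (hmul p f (hle f.2) g (hle g.2)).1
  · exact congrArg (snd h P) (hψr x)
  · refine IsOpHom.eq_of_eqOn mF _ hχ.1 (fun p f g => ?_) ?_
    · exact congrArg (snd h P) (hmul p f (hle f.2) g (hle g.2)).1
    · rintro _ ⟨x, rfl⟩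
      exact (hχ.2 x).trans (congrArg (snd h P) (hψr x)).symm

end Universal

/-! ### Tri-algebras and di-algebras -/

/-- The operation symbols of `triTree`. -/
noncomputable def triLab (p q : Prop) : TriOp :=
  open Classical in if q then if p then .perp else .vdash else .dashv

/-- The operation symbols of `diTree`. -/
noncomputable def diLab (_ q : Prop) : DiOp :=
  open Classical in if q then .vdash else .dashv

theorem triLab_true_false : triLab True False = .dashv := by simp [triLab]

theorem triLab_false_true : triLab False True = .vdash := by simp [triLab]

theorem triLab_true_true : triLab True True = .perp := by simp [triLab]

theorem diLab_true_false : diLab True False = .dashv := by simp [diLab]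

theorem diLab_false_true : diLab False True = .vdash := by simp [diLab]

theorem triTree_eq_emphTree (H : Finset ℕ) :
    ∀ t : FreeMagma ℕ, triTree H t = emphTree triLab H t
  | .of _ => rfl
  | .mul s t => by
    rw [triTree, emphTree, triTree_eq_emphTree H s, triTree_eq_emphTree H t]
    rfl

theorem diTree_eq_emphTree (i : ℕ) :
    ∀ t : FreeMagma ℕ, diTree i t = emphTree diLab {i} t
  | .of _ => rfl
  | .mul s t => by
    rw [diTree, emphTree, diTree_eq_emphTree i s, diTree_eq_emphTree i t]
    simp [diLab]

section Varieties

variable {k : Type u} [Field k] {S : Set (Alg k ℕ)} {A : Type w} [AddCommGroup A] [Module k A]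

theorem inTriVar_iff {m : Ops TriOp k A} :
    InTriVar S m ↔ InRepVar S triLab Finset.Nonempty m := by
  have ht (H : Finset ℕ) : triTree H = emphTree triLab H := funext (triTree_eq_emphTree H)
  simp only [InTriVar, triPoly, ht]
  constructor
  · rintro ⟨h1, h2, h3⟩
    exact ⟨by rwa [triLab_false_true], by rwa [triLab_true_false], h3⟩
  · rintro ⟨h1, h2, h3⟩
    rw [triLab_false_true] at h1
    rw [triLab_true_false] at h2
    exact ⟨h1, h2, h3⟩

theorem inDiVar_iff {m : Ops DiOp k A} :
    InDiVar S m ↔ InRepVar S diLab (fun H => ∃ i, H = {i}) m := by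
  have ht (i : ℕ) : diTree i = emphTree diLab {i} := funext (diTree_eq_emphTree i)
  simp only [InDiVar, diPoly, ht]
  constructor
  · rintro ⟨h1, h2, h3⟩
    refine ⟨by rwa [diLab_false_true], by rwa [diLab_true_false], ?_⟩
    rintro Φ hΦ n hn _ ⟨i, rfl⟩ hi
    exact h3 Φ hΦ n hn i (Finset.singleton_subset_iff.1 hi)
  · rintro ⟨h1, h2, h3⟩
    rw [diLab_false_true] at h1
    rw [diLab_true_false] at h2
    exact ⟨h1, h2, fun Φ hΦ n hn i hi =>
      h3 Φ hΦ n hn {i} ⟨i, rfl⟩ (Finset.singleton_subset_iff.2 hi)⟩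

variable (S) (X : Type v)

theorem isFreeTriVar_triV (hS : ∀ Φ ∈ S, ∃ n, IsPolylinear n Φ) :
    IsFreeTriVar.{u, w} S (triVOps S X) (triDot S X) := by
  constructor
  · refine inTriVar_iff.2 (InRepVar.generated _ _ (inRepVar_of_endomorphism triLab _
      ((incl S X).comp (φ S X)) (FreeVar.inVar S _) ?_ ?_ ?_ (fun _ h => h) (.inl ?_)))
    · rintro (_ | _ | _) f g
      · exact (φF_mul S X _ _).trans (congrArg _ (φF_φF S X g))
      · exact (φF_mul S X _ _).trans (congrArg (· * _) (φF_φF S X f))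
      · exact φF_mul S X f g
    · rw [triLab_true_false]
      exact fun _ _ => rfl
    · rw [triLab_false_true]
      exact fun _ _ => rfl
    · rw [triLab_true_true]
      exact fun _ _ => rfl
  · intro B _ _ mB hB α
    have hB' := inTriVar_iff.1 hB
    have h : IsBar mB (triLab True False) (triLab False True) := ⟨hB'.left_bar, hB'.right_bar⟩
    have hV := hB'.splitExt h (mB (triLab True True)) hS Finset.singleton_nonempty
      (.inl ⟨rfl, fun _ hH => hH⟩)
    refine existsUnique_hom (mF := triF S X) ?_ ?_ h _ hV ?_ α
    · rw [triLab_true_false]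
      exact fun _ _ => rfl
    · rw [triLab_false_true]
      exact fun _ _ => rfl
    · rw [triLab_true_false, triLab_false_true, triLab_true_true]
      rintro (_ | _ | _)
      · exact .inl rfl
      · exact .inr (.inl rfl)
      · exact .inr (.inr ⟨fun _ _ => rfl, rfl⟩)

theorem isFreeDiVar_diV (hS : ∀ Φ ∈ S, ∃ n, IsPolylinear n Φ) :
    IsFreeDiVar.{u, w} S (diVOps S X) (diDot S X) := by
  constructor
  · refine inDiVar_iff.2 (InRepVar.generated _ _ (inRepVar_of_endomorphism diLab _
      ((incl S X).comp (φ S X)) (FreeVar.inVar S _) ?_ ?_ ?_ ?_ (.inr ?_)))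
    · rintro (_ | _) f g
      · exact (φF_mul S X _ _).trans (congrArg _ (φF_φF S X g))
      · exact (φF_mul S X _ _).trans (congrArg (· * _) (φF_φF S X f))
    · rw [diLab_true_false]
      exact fun _ _ => rfl
    · rw [diLab_false_true]
      exact fun _ _ => rfl
    · rintro _ ⟨i, rfl⟩
      exact Finset.singleton_nonempty i
    · rintro _ ⟨i, rfl⟩
      exact (Finset.card_singleton i).le
  · intro B _ _ mB hB α
    have hB' := inDiVar_iff.1 hB
    have h : IsBar mB (diLab True False) (diLab False True) := ⟨hB'.left_bar, hB'.right_bar⟩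
    have hV := hB'.splitExt h 0 hS (fun i => ⟨i, rfl⟩) (.inr rfl)
    refine existsUnique_hom (mF := diF S X) ?_ ?_ h _ hV ?_ α
    · rw [diLab_true_false]
      exact fun _ _ => rfl
    · rw [diLab_false_true]
      exact fun _ _ => rfl
    · rw [diLab_true_false, diLab_false_true]
      rintro (_ | _)
      · exact .inl rfl
      · exact .inr (.inl rfl)

theorem triV_eq_span :
    triV S X = Submodule.span k {f | ∃ t, 0 < dotDegree t ∧ monomial S X t = f} := by
  refine generated_eq_span (m := triF S X) (d := .dashv) (v := .vdash) (fun _ _ => rfl)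
    (fun _ _ => rfl) (0 < ·) one_pos (fun _ h => h) ?_ (.inl ⟨⟨.perp, fun _ _ => rfl⟩, fun _ h => h⟩)
  rintro (_ | _ | _)
  · exact .inl rfl
  · exact .inr (.inl rfl)
  · exact .inr (.inr ⟨fun _ _ => rfl, fun _ h => h⟩)

theorem diV_eq_span :
    diV S X = Submodule.span k {f | ∃ t, dotDegree t = 1 ∧ monomial S X t = f} := by
  refine generated_eq_span (m := diF S X) (d := .dashv) (v := .vdash) (fun _ _ => rfl)
    (fun _ _ => rfl) (· = 1) rfl (fun _ h => h ▸ one_pos) ?_ (.inr fun _ h => h.le)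
  rintro (_ | _)
  · exact .inl rfl
  · exact .inr (.inl rfl)

end Varieties

end Replication

theorem theorem3p3 {k : Type u} [Field k] (S : Set (Alg k ℕ))
    (hS : ∀ Φ ∈ S, ∃ n, IsPolylinear n Φ) (X : Type v) :
    (triV S X = Submodule.span k {f | ∃ t, 0 < dotDegree t ∧ monomial S X t = f} ∧
      IsFreeTriVar.{u, w} S (triVOps S X) (triDot S X)) ∧
    (diV S X = Submodule.span k {f | ∃ t, dotDegree t = 1 ∧ monomial S X t = f} ∧
      IsFreeDiVar.{u, w} S (diVOps S X) (diDot S X)) :=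
  ⟨⟨triV_eq_span S X, isFreeTriVar_triV S X hS⟩, diV_eq_span S X, isFreeDiVar_diV S X hS⟩
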